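/- Let $(K,d)$ be a complete metric space with its Borel $\sigma$-algebra, and let $D_R=(K,w'_{e'},p'_{e'})_{e'\in E'}$ be a random dynamical system: $E'$ is at most countable, $w'_{e'}:K\to K$ and $p'_{e'}:K\to[0,1]$ are Borel measurable, and $\sum_{e'\in E'}p'_{e'}(x)=1$ for all $x\in K$. Suppose that $D_R$ has a Markov partition: there are $N\subset\mathbb N$ with $1\in N$ and a partition $(K_j)_{j\in N}$ of $K$ into non-empty Borel sets such that the restrictions of the maps and probability functions of $D_R$ to the sets $K_j$ (those whose probability function is not identically zero on $K_j$, re-indexed by a set $E$) form a countable Markov system $\mathcal M=(K_{i(e)},w_e,p_e)_{e\in E}$. That is, $E$ is at most countable, there are maps $i,t:E\to N$ with $i$ surjective, and there are Borel measurable $w_e:K_{i(e)}\to K_{t(e)}$ and $p_e:K_{i(e)}\to[0,1]$ such that $p_e$ is not identically zero and $\sum_{e:\,i(e)=j}p_e(y)=1$ for all $y\in K_j$, $j\in N$; and there is a map $c:E\to E'$ with $w_e=w'_{c(e)}|_{K_{i(e)}}$ and $p_e=p'_{c(e)}|_{K_{i(e)}}$, such that $e\mapsto(c(e),i(e))$ is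 a bijection of $E$ onto the set of all pairs $(e',j)$ for which $p'_{e'}$ does not vanish identically on $K_j$. Extend each $p_e$ to $K$ by zero and each $w_e$ arbitrarily. For $f\ge 0$ Borel, put $Uf=\sum_{e\in E}p_e\cdot(f\circ w_e)$. A Borel probability measure $\mu$ on $K$ is invariant if $\int Uf\,d\mu=\int f\,d\mu$ for all bounded Borel $f\ge0$. Let $\bar E=E\cup\{\infty\}$ be the one-point compactification of the discrete set $E$, with $i(\infty)=t(\infty)=1$, and let $\bar\Sigma=\bar E^{\mathbb Z}$, with the product topology, its Borel $\sigma$-algebra and the left shift $S$. Let $\mathcal F$ be the $\sigma$-algebra on $\bar\Sigma$ generated by the coordinates $\sigma_m$, $m\le 0$, let ${}_1[e]=\{\sigma\in\bar\Sigma:\sigma_1=e\}$, let $\Sigma_G=\{\sigma\in\bar\Sigma:\sigma_n\in E,\ i(\sigma_{n+1})=t(\sigma_n)\text{ for all }n\in\mathbb Z\}$, and let $T_j=\{\sigma\in\Sigma_G:t(\sigma_0)=j\}$. Fix points $x_j\in K_j$, $j\in N$. Let $D$ be the set of all $\sigma\in\Sigma_G$ for which $\lim_{m\to-\infty}w_{\sigma_0}\circ\dots\circ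 w_{\sigma_m}(x_{i(\sigma_m)})$ exists, and let $F:\bar\Sigma\to K$ be the coding map: $F(\sigma)$ is this limit if $\sigma\in D$, and $F(\sigma)=x_{t(\sigma_0)}$ otherwise. For a measure $\Lambda$ on $\bar\Sigma$ put $F(\Lambda)(B)=\Lambda(F^{-1}(B))$ for Borel $B\subset K$. Suppose that each $w'_{e'}$ and each $p'_{e'}$ is continuous on $K$; that $\mathcal M$ is uniformly continuous, i.e. $w_e|_{K_{i(e)}}$ and $p_e|_{K_{i(e)}}$ are uniformly continuous for every $e\in E$; and that $\mathcal M$ has a dominating Markov chain, i.e. $\sum_{e:\,i(e)=j}\sup_{x\in K_j}p_e(x)<\infty$ for every $j\in N$. Let $\bar p_e$ be the continuous extension of $p_e|_{K_{i(e)}}$ to the closure of $K_{i(e)}$, extended further to $K$ by zero. An asymptotic state of $\mathcal M$ is a shift-invariant Borel probability measure $\Lambda$ on $\bar\Sigma$ with $\Lambda(D)=1$ and $$E_\Lambda\left(1_{{}_1[e]}\,\middle|\,\mathcal F\right)=(\bar p_e\circ F)\,1_{T_{i(e)}}\quad\Lambda\text{-a.e., for all }e\in E.$$ Then $\mathcal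 M$ is consistent: for every asymptotic state $\Lambda$ of $\mathcal M$, the measure $F(\Lambda)$ is an invariant Borel probability measure. -/

import Mathlib

open MeasureTheory Filter Topology
open scoped ENNReal

noncomputable section

/-! ## Random dynamical systems and Markov systems -/

/-- A random dynamical system `(K, w_e, p_e)_{e ∈ E'}`: countably many Borel maps `w e : K → K`
together with Borel probability functions `p e : K → [0, 1]` which sum to one at every point. -/
structure RandomDynamicalSystem (K E' : Type*) [MeasurableSpace K] where
  w : E' → K → K
  p : E' → K → ℝ
  countable_index : Countable E'
  measurable_w : ∀ e, Measurable (w e)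
  measurable_p : ∀ e, Measurable (p e)
  p_mem : ∀ e x, p e x ∈ Set.Icc (0 : ℝ) 1
  hasSum_p : ∀ x, HasSum (fun e => p e x) 1

/-- The maps and the probability functions of the random dynamical system are continuous. -/
def RandomDynamicalSystem.IsContinuous {K E' : Type*} [TopologicalSpace K] [MeasurableSpace K]
    (R : RandomDynamicalSystem K E') : Prop :=
  ∀ e, Continuous (R.w e) ∧ Continuous (R.p e)

/-- A countable Markov system `(K_{i(e)}, w_e, p_e)_{e ∈ E}`. The vertex sets `V j`, `j ∈ N ⊆ ℕ`,
form a partition of `K` into non-empty Borel sets, `i` and `t` are the initial and the terminal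
vertex of an edge. `w e` and `p e` matter on `V (i e)` only: `p e` is extended to `K` by zero and
`w e` arbitrarily. -/
structure MarkovSystem (K E : Type*) [MeasurableSpace K] (N : Set ℕ) where
  one_mem : 1 ∈ N
  countable_index : Countable E
  V : N → Set K
  V_nonempty : ∀ j, (V j).Nonempty
  V_measurable : ∀ j, MeasurableSet (V j)
  V_disjoint : Pairwise fun j k => Disjoint (V j) (V k)
  V_cover : ⋃ j, V j = Set.univ
  i : E → N
  t : E → N
  i_surjective : Function.Surjective i
  w : E → K → K
  p : E → K → ℝ
  w_mapsTo : ∀ e, Set.MapsTo (w e) (V (i e)) (V (t e))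
  w_measurable : ∀ e, Measurable fun x : V (i e) => w e x
  p_measurable : ∀ e, Measurable fun x : V (i e) => p e x
  p_mem : ∀ e, ∀ x ∈ V (i e), p e x ∈ Set.Icc (0 : ℝ) 1
  p_eq_zero : ∀ e, ∀ x ∉ V (i e), p e x = 0
  p_pos : ∀ e, ∃ x ∈ V (i e), 0 < p e x
  hasSum_p : ∀ j, ∀ x ∈ V j, HasSum (fun e : {e : E // i e = j} => p e x) 1

/-- The Markov operator `U f = ∑ e, p_e · (f ∘ w_e)` on non-negative functions. -/
def markovOperator {K E : Type*} (w : E → K → K) (p : E → K → ℝ) (f : K → ℝ≥0∞) : K → ℝ≥0∞ :=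
  fun x => ∑' e, ENNReal.ofReal (p e x) * f (w e x)

/-! ## The code space -/

/-- The alphabet `E ∪ {∞}`, the one-point compactification of the discrete set `E`. -/
def Letter (E : Type*) : Type _ := OnePoint E

namespace Letter

/-- A letter of `E`, as an element of `E ∪ {∞}`. -/
def of {E : Type*} (e : E) : Letter E := OnePoint.some e

/-- The topology of the one-point compactification, for the discrete topology on `E`. -/
instance {E : Type*} : TopologicalSpace (Letter E) :=
  letI : TopologicalSpace E := ⊥
  inferInstanceAs (TopologicalSpace (OnePoint E))

/-- All subsets of `E ∪ {∞}` are measurable (for countable `E` these are the Borel sets). -/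
instance {E : Type*} : MeasurableSpace (Letter E) := ⊤

instance {E : Type*} [Countable E] : Countable (Letter E) :=
  inferInstanceAs (Countable (Option E))

instance {E : Type*} : T2Space (Letter E) :=
  letI : TopologicalSpace E := ⊥
  haveI : DiscreteTopology E := ⟨rfl⟩
  inferInstanceAs (T2Space (OnePoint E))

instance {E : Type*} [Countable E] : FirstCountableTopology (Letter E) := by
  let _ : TopologicalSpace E := ⊥
  have _ : DiscreteTopology E := ⟨rfl⟩
  suffices h : FirstCountableTopology (OnePoint E) from h
  have hc : (cofinite : Filter E).IsCountablyGenerated :=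
    Filter.HasCountableBasis.isCountablyGenerated
      ⟨Filter.hasBasis_cofinite, Set.Countable.ofPred_finite⟩
  refine ⟨fun a => ?_⟩
  induction a with
  | infty =>
    rw [OnePoint.nhds_infty_eq, coclosedCompact_eq_cocompact, cocompact_eq_cofinite]
    infer_instance
  | coe a =>
    rw [OnePoint.nhds_coe_eq, nhds_discrete]
    infer_instance

instance {E : Type*} [Countable E] : BorelSpace (Letter E) := by
  refine ⟨le_antisymm (fun s _ => ?_) le_top⟩
  let _ : MeasurableSpace (Letter E) := borel (Letter E)
  have _ : BorelSpace (Letter E) := ⟨rfl⟩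
  exact s.to_countable.measurableSet

end Letter

/-- The code space: two-sided sequences in `E ∪ {∞}`, with the product topology and the product
`σ`-algebra (for countable `E` this is the Borel `σ`-algebra, see the fact below). -/
abbrev CodeSpace (E : Type*) : Type _ := ℤ → Letter E

theorem CodeSpace.borelSpace {E : Type*} [Countable E] : BorelSpace (CodeSpace E) :=
  inferInstance

namespace CodeSpace

variable {E : Type*}

/-- The left shift. -/
def shift (σ : CodeSpace E) : CodeSpace E := fun n => σ (n + 1)

/-- The cylinder set `_m[a_m, …, a_n]`. -/
def cylinder (m n : ℤ) (a : ℤ → Letter E) : Set (CodeSpace E) :=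
  {σ | ∀ k, m ≤ k → k ≤ n → σ k = a k}

/-- The `σ`-algebra `𝓕` of the past, generated by the cylinder sets `_m[a_m, …, a_0]`,
`m ≤ 0`. -/
@[reducible] def past (E : Type*) : MeasurableSpace (CodeSpace E) :=
  MeasurableSpace.generateFrom {A | ∃ m : ℤ, m ≤ 0 ∧ ∃ a : ℤ → Letter E, A = cylinder m 0 a}

theorem past_le : past E ≤ MeasurableSpace.pi := by
  refine MeasurableSpace.generateFrom_le ?_
  rintro _ ⟨m, -, a, rfl⟩
  have : cylinder m 0 a = ⋂ k : ℤ, ⋂ _ : m ≤ k, ⋂ _ : k ≤ 0,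
      (fun σ : CodeSpace E => σ k) ⁻¹' {a k} := by
    ext σ
    simp [cylinder]
  rw [this]
  exact MeasurableSet.iInter fun k => MeasurableSet.iInter fun _ => MeasurableSet.iInter fun _ =>
    measurable_pi_apply k (by trivial)

/-- The set `_1[e]` of all codes whose entry at time `1` is `e`. -/
def nextIs (e : E) : Set (CodeSpace E) := cylinder 1 1 fun _ => Letter.of e

end CodeSpace

namespace MarkovSystem

open CodeSpace

variable {K E : Type*} [MeasurableSpace K] {N : Set ℕ} (M : MarkovSystem K E N)

/-- The initial vertex of a letter, with `i(∞) = 1`. -/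
def iExt (a : Letter E) : N := OnePoint.elim a ⟨1, M.one_mem⟩ M.i

/-- The terminal vertex of a letter, with `t(∞) = 1`. -/
def tExt (a : Letter E) : N := OnePoint.elim a ⟨1, M.one_mem⟩ M.t

/-- The map of a letter, with `w_∞ = id`. -/
def wExt (a : Letter E) : K → K := OnePoint.elim a id M.w

/-- The path space `Σ_G`. -/
def pathSpace : Set (CodeSpace E) :=
  {σ | ∀ n, M.iExt (σ (n + 1)) = M.tExt (σ n) ∧ ∃ e : E, σ n = Letter.of e}

/-- The set `T_j` of the paths which are at the vertex `j` after time `0`. -/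
def arrivesAt (j : N) : Set (CodeSpace E) := {σ | σ ∈ M.pathSpace ∧ M.tExt (σ 0) = j}

/-- `M.backward σ n = w_{σ_0} ∘ w_{σ_{-1}} ∘ ⋯ ∘ w_{σ_{-n}}`. -/
def backward (M : MarkovSystem K E N) (σ : CodeSpace E) : ℕ → K → K
  | 0 => M.wExt (σ 0)
  | n + 1 => backward M σ n ∘ M.wExt (σ (-((n : ℤ) + 1)))

/-- The set `D` of the paths `σ` along which `w_{σ_0} ∘ ⋯ ∘ w_{σ_m} (x_{i(σ_m)})` converges as
`m → -∞`, for the chosen base points `x_j ∈ V j`. -/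
def convergenceSet [TopologicalSpace K] (x : ∀ j, M.V j) : Set (CodeSpace E) :=
  {σ | σ ∈ M.pathSpace ∧ ∃ y : K,
    Tendsto (fun n : ℕ => M.backward σ n (x (M.iExt (σ (-(n : ℤ)))))) atTop (𝓝 y)}

open Classical in
/-- The coding map `F`: the above limit on `D`, and `x_{t(σ_0)}` elsewhere. -/
def codingMap [TopologicalSpace K] (x : ∀ j, M.V j) (σ : CodeSpace E) : K :=
  if h : σ ∈ M.convergenceSet x then h.2.choose else x (M.tExt (σ 0))

/-- The continuous extension of `p_e` from `V (i e)` to its closure, extended further by zero. -/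
def pBar [TopologicalSpace K] (e : E) : K → ℝ :=
  (closure (M.V (M.i e))).indicator (extendFrom (M.V (M.i e)) (M.p e))

/-- The asymptotic states of the Markov system: shift-invariant Borel probability measures `Λ` on
the code space with `Λ(D) = 1` and `E_Λ(1_{_1[e]} | 𝓕) = (pBar e ∘ F) · 1_{T_{i(e)}}` almost
everywhere, for all edges `e`. -/
structure IsAsymptoticState [TopologicalSpace K] (x : ∀ j, M.V j)
    (Λ : Measure (CodeSpace E)) : Prop where
  isProbabilityMeasure : IsProbabilityMeasure Λ
  shift_invariant : MeasurePreserving shift Λ Λ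
  convergence : Λ (M.convergenceSet x) = 1
  condExp_eq : ∀ e : E,
    Λ[(nextIs e).indicator (fun _ => (1 : ℝ)) | past E] =ᵐ[Λ]
      (M.arrivesAt (M.i e)).indicator fun σ => M.pBar e (M.codingMap x σ)

/-- `μ` is an invariant Borel probability measure: `U* μ = μ`, where
`U* μ (f) = ∫ U f dμ` for bounded non-negative Borel functions `f`. -/
def IsInvariant (μ : Measure K) : Prop :=
  IsProbabilityMeasure μ ∧
    ∀ f : K → ℝ≥0∞, Measurable f → (∃ C : ℝ≥0∞, C ≠ ∞ ∧ ∀ x, f x ≤ C) →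
      ∫⁻ x, markovOperator M.w M.p f x ∂μ = ∫⁻ x, f x ∂μ

/-- The Markov system is consistent if the coding map sends every asymptotic state to an
invariant measure. -/
def IsConsistent [TopologicalSpace K] (x : ∀ j, M.V j) : Prop :=
  ∀ Λ : Measure (CodeSpace E), M.IsAsymptoticState x Λ →
    M.IsInvariant (Λ.map (M.codingMap x))

/-- Each `w_e` and each `p_e` is uniformly continuous on `V (i e)`. -/
def IsUniformlyContinuous [UniformSpace K] : Prop :=
  ∀ e, UniformContinuousOn (M.w e) (M.V (M.i e)) ∧ UniformContinuousOn (M.p e) (M.V (M.i e))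

/-- `∑_{e : i(e) = j} sup_{V j} p_e < ∞` for every vertex `j`. -/
def HasDominatingMarkovChain : Prop :=
  ∀ j : N, ∑' e : {e : E // M.i e = j}, ⨆ x ∈ M.V j, ENNReal.ofReal (M.p e x) < ∞

/-- The Markov system results from the random dynamical system `R` by restricting its maps and
probability functions to the atoms of a Markov partition, up to the indexing: the edges `e`
correspond, through `e ↦ (c e, i e)`, to the pairs of an index `e'` of `R` and a vertex `j` for
which the probability function `p_{e'}` does not vanish identically on `V j`. -/
def IsAssociatedWith {E' : Type*} (R : RandomDynamicalSystem K E') : Prop :=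
  ∃ c : E → E',
    Function.Injective (fun e => (c e, M.i e)) ∧
    (∀ e' j, (∃ y ∈ M.V j, 0 < R.p e' y) → ∃ e, c e = e' ∧ M.i e = j) ∧
    ∀ e, Set.EqOn (M.w e) (R.w (c e)) (M.V (M.i e)) ∧
      Set.EqOn (M.p e) (R.p (c e)) (M.V (M.i e))

end MarkovSystem

end

/-!
On the path space, `σ₁ = e` forces `F(S σ) = w'_{c(e)}(F σ)` by continuity of `w'_{c(e)}`. Shift
invariance and the defining property of an asymptotic state therefore give
`∫ f ∘ F dΛ = ∑ₑ ∫_{₁[e]} f ∘ w'_{c(e)} ∘ F dΛ = ∑ₑ ∫_{T_{i(e)}} (p̄ₑ · f ∘ w'_{c(e)}) ∘ F dΛ`.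
On `T_j` the point `F σ` lies in the closure of `K_j`. There `p̄ₑ = p'_{c(e)}` for the edges `e`
leaving `j`, and every other `p'_{e'}` vanishes, so that the last sum is `∫ (U f) ∘ F dΛ`.
-/

theorem exists_pos_of_mem_closure {X : Type*} [TopologicalSpace X] {g : X → ℝ}
    (hg : Continuous g) {s : Set X} {y : X} (hy : y ∈ closure s) (hpos : 0 < g y) :
    ∃ z ∈ s, 0 < g z := by
  obtain ⟨z, hz, hzs⟩ := mem_closure_iff.1 hy _ (isOpen_lt continuous_const hg) hpos
  exact ⟨z, hzs, hz⟩

section CondExp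

variable {Ω : Type*} {m m₀ : MeasurableSpace Ω} {μ : Measure Ω}

theorem lintegral_condLExp_mul (hm : m ≤ m₀) [SigmaFinite (μ.trim hm)] {X g : Ω → ℝ≥0∞}
    (hX : AEMeasurable X μ) (hg : Measurable[m] g) :
    ∫⁻ ω, (μ⁻[X|m]) ω * g ω ∂μ = ∫⁻ ω, X ω * g ω ∂μ := by
  have htrim : (μ.withDensity (μ⁻[X|m])).trim hm = (μ.withDensity X).trim hm := by
    refine @Measure.ext _ m _ _ fun s hs => ?_
    rw [trim_measurableSet_eq hm hs, trim_measurableSet_eq hm hs, withDensity_apply _ (hm s hs),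
      withDensity_apply _ (hm s hs), setLIntegral_condLExp hm μ X hs]
  have hg₀ : Measurable g := hg.mono hm le_rfl
  calc ∫⁻ ω, (μ⁻[X|m]) ω * g ω ∂μ
      = ∫⁻ ω, g ω ∂(μ.withDensity (μ⁻[X|m])).trim hm := by
        rw [lintegral_trim hm hg,
          lintegral_withDensity_eq_lintegral_mul _ (measurable_condLExp' m μ X) hg₀]
        rfl
    _ = ∫⁻ ω, X ω * g ω ∂μ := by
        rw [htrim, lintegral_trim hm hg,
          lintegral_withDensity_eq_lintegral_mul₀ hX hg₀.aemeasurable]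
        rfl

theorem lintegral_ofReal_condExp_indicator_mul (hm : m ≤ m₀) [IsFiniteMeasure μ] {A : Set Ω}
    (hA : MeasurableSet A) {g : Ω → ℝ≥0∞} (hg : AEStronglyMeasurable[m] g μ) :
    ∫⁻ ω, ENNReal.ofReal ((μ[A.indicator (fun _ => (1 : ℝ)) | m]) ω) * g ω ∂μ =
      ∫⁻ ω in A, g ω ∂μ := by
  set X : Ω → ℝ := A.indicator fun _ => 1
  have hX : Integrable X μ := (integrable_const 1).indicator hA
  have hX₀ : 0 ≤ᵐ[μ] X := ae_of_all μ (Set.indicator_nonneg fun _ _ => zero_le_one)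
  calc ∫⁻ ω, ENNReal.ofReal ((μ[X | m]) ω) * g ω ∂μ
      = ∫⁻ ω, (μ⁻[fun ω => ENNReal.ofReal (X ω)|m]) ω * hg.mk g ω ∂μ := by
        refine lintegral_congr_ae ?_
        filter_upwards [condLExp_ofReal m hX hX₀, hg.ae_eq_mk] with ω h₁ h₂
        rw [h₁, h₂]
    _ = ∫⁻ ω, ENNReal.ofReal (X ω) * hg.mk g ω ∂μ :=
        lintegral_condLExp_mul hm hX.aemeasurable.ennreal_ofReal hg.stronglyMeasurable_mk.measurable
    _ = ∫⁻ ω, A.indicator g ω ∂μ := by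
        refine lintegral_congr_ae ?_
        filter_upwards [hg.ae_eq_mk] with ω hω
        by_cases h : ω ∈ A <;> simp [X, h, hω]
    _ = ∫⁻ ω in A, g ω ∂μ := lintegral_indicator hA g

end CondExp

namespace CodeSpace

variable {E : Type*}

section Past

variable [Countable E] {m : ℤ}

theorem measurable_past_domRestrict (hm : m ≤ 0) :
    Measurable[past E] fun σ : CodeSpace E => (Set.Icc m 0).domRestrict σ := by
  refine @measurable_to_countable _ (CodeSpace E) _ _ (past E) _ fun τ => ?_
  have h : (fun σ : CodeSpace E => (Set.Icc m 0).domRestrict σ) ⁻¹' {(Set.Icc m 0).domRestrict τ} =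
      cylinder m 0 τ := by
    ext σ
    simp [cylinder, funext_iff]
  rw [h]
  exact MeasurableSpace.measurableSet_generateFrom ⟨m, hm, τ, rfl⟩

theorem stronglyMeasurable_past_of_dependsOn {Y : Type*} [TopologicalSpace Y] [Nonempty Y]
    {f : CodeSpace E → Y} (hm : m ≤ 0) (hf : DependsOn f (Set.Icc m 0)) :
    StronglyMeasurable[past E] f := by
  obtain ⟨g, rfl⟩ := dependsOn_iff_exists_comp.1 hf
  exact (StronglyMeasurable.of_discrete (f := g)).comp_measurable (measurable_past_domRestrict hm)

end Past

theorem mem_nextIs {σ : CodeSpace E} {e : E} : σ ∈ nextIs e ↔ σ 1 = Letter.of e :=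
  ⟨fun h => h 1 le_rfl le_rfl, fun h _ h₁ h₂ => le_antisymm h₂ h₁ ▸ h⟩

theorem measurableSet_nextIs (e : E) : MeasurableSet (nextIs e) := by
  have h : nextIs e = (fun σ : CodeSpace E => σ 1) ⁻¹' {Letter.of e} := Set.ext fun _ => mem_nextIs
  rw [h]
  exact measurable_pi_apply 1 (by trivial)

theorem pairwise_disjoint_nextIs : Pairwise (Function.onFun Disjoint (nextIs (E := E))) :=
  fun _ _ hne => Set.disjoint_left.2 fun _ h₁ h₂ =>
    hne (OnePoint.coe_injective ((mem_nextIs.1 h₁).symm.trans (mem_nextIs.1 h₂)))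

theorem lintegral_eq_tsum_setLIntegral_nextIs [Countable E] {Λ : Measure (CodeSpace E)}
    (hΛ : ∀ᵐ σ ∂Λ, ∃ e : E, σ 1 = Letter.of e) (g : CodeSpace E → ℝ≥0∞) :
    ∫⁻ σ, g σ ∂Λ = ∑' e, ∫⁻ σ in nextIs e, g σ ∂Λ := by
  rw [← lintegral_iUnion measurableSet_nextIs pairwise_disjoint_nextIs,
    Measure.restrict_eq_self_of_ae_mem]
  filter_upwards [hΛ] with σ ⟨e, he⟩ using Set.mem_iUnion.2 ⟨e, mem_nextIs.2 he⟩

end CodeSpace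

theorem RandomDynamicalSystem.measurable_markovOperator {K E' : Type*} [MeasurableSpace K]
    (R : RandomDynamicalSystem K E') {f : K → ℝ≥0∞} (hf : Measurable f) :
    Measurable (markovOperator R.w R.p f) := by
  have := R.countable_index
  exact Measurable.tsum fun e =>
    (R.measurable_p e).ennreal_ofReal.mul (hf.comp (R.measurable_w e))

namespace MarkovSystem

open CodeSpace

variable {K E : Type*} [MeasurableSpace K] {N : Set ℕ} (M : MarkovSystem K E N)

section BackwardOrbit

variable (x : ∀ j, M.V j)

theorem dependsOn_backward (n : ℕ) :
    DependsOn (fun σ => M.backward σ n) (Set.Icc (-(n : ℤ)) 0) := by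
  induction n with
  | zero =>
    intro σ τ h
    simp [backward, h 0]
  | succ n ih =>
    intro σ τ h
    have hn : M.backward σ n = M.backward τ n :=
      ih.mono (Set.Icc_subset_Icc_left (by push_cast; lia)) h
    simp only [backward, hn, h (-((n : ℤ) + 1)) ⟨by push_cast; lia, by lia⟩]

theorem backward_shift_succ (σ : CodeSpace E) (n : ℕ) :
    M.backward (shift σ) (n + 1) = M.wExt (σ 1) ∘ M.backward σ n := by
  induction n with
  | zero => simp [backward, shift]
  | succ n ih =>
    have hs : shift σ (-(((n + 1 : ℕ) : ℤ) + 1)) = σ (-((n : ℤ) + 1)) :=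
      congrArg σ (by push_cast; ring)
    rw [backward, ih, hs, backward, Function.comp_assoc]

theorem backward_mapsTo {σ : CodeSpace E} (hσ : σ ∈ M.pathSpace) (n : ℕ) :
    Set.MapsTo (M.backward σ n) (M.V (M.iExt (σ (-(n : ℤ))))) (M.V (M.tExt (σ 0))) := by
  have hw (k : ℤ) : Set.MapsTo (M.wExt (σ k)) (M.V (M.iExt (σ k))) (M.V (M.tExt (σ k))) := by
    obtain ⟨e, he⟩ := (hσ k).2
    rw [he]
    exact M.w_mapsTo e
  induction n with
  | zero => exact hw 0
  | succ n ih =>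
    have hlink : M.iExt (σ (-(n : ℤ))) = M.tExt (σ (-((n : ℤ) + 1))) := by
      rw [← (hσ _).1]
      congr 2
      ring
    rw [hlink] at ih
    exact_mod_cast ih.comp (hw (-((n : ℤ) + 1)))

/-- The point `w_{σ_0} ∘ ⋯ ∘ w_{σ_{-n}} (x_{i(σ_{-n})})`; the coding map is the limit of these
points as `n → ∞`. -/
def backwardOrbit (n : ℕ) (σ : CodeSpace E) : K :=
  M.backward σ n (x (M.iExt (σ (-(n : ℤ)))))

theorem backwardOrbit_mem {σ : CodeSpace E} (hσ : σ ∈ M.pathSpace) (n : ℕ) :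
    M.backwardOrbit x n σ ∈ M.V (M.tExt (σ 0)) :=
  M.backward_mapsTo hσ n (x _).2

theorem backwardOrbit_succ_shift (n : ℕ) (σ : CodeSpace E) :
    M.backwardOrbit x (n + 1) (shift σ) = M.wExt (σ 1) (M.backwardOrbit x n σ) := by
  have hs : shift σ (-((n + 1 : ℕ) : ℤ)) = σ (-(n : ℤ)) := congrArg σ (by push_cast; ring)
  rw [backwardOrbit, backward_shift_succ, hs]
  rfl

theorem dependsOn_backwardOrbit (n : ℕ) :
    DependsOn (M.backwardOrbit x n) (Set.Icc (-(n : ℤ)) 0) := fun σ τ h => by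
  have hn : M.backward σ n = M.backward τ n := M.dependsOn_backward n h
  rw [backwardOrbit, backwardOrbit, hn, h _ ⟨le_rfl, by lia⟩]

theorem stronglyMeasurable_past_backwardOrbit [TopologicalSpace K] (n : ℕ) :
    StronglyMeasurable[past E] (M.backwardOrbit x n) :=
  have := M.countable_index
  have : Nonempty K := ⟨x ⟨1, M.one_mem⟩⟩
  stronglyMeasurable_past_of_dependsOn (by lia) (M.dependsOn_backwardOrbit x n)

end BackwardOrbit

section PathSpace

theorem shift_mem_pathSpace {σ : CodeSpace E} (hσ : σ ∈ M.pathSpace) : shift σ ∈ M.pathSpace :=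
  fun n => hσ (n + 1)

theorem measurableSet_pathSpace : MeasurableSet M.pathSpace := by
  have := M.countable_index
  have h : M.pathSpace = ⋂ n : ℤ, (fun σ : CodeSpace E => (σ (n + 1), σ n)) ⁻¹'
      {a | M.iExt a.1 = M.tExt a.2 ∧ ∃ e : E, a.2 = Letter.of e} := by
    ext σ
    simp [pathSpace]
  rw [h]
  exact MeasurableSet.iInter fun n =>
    ((measurable_pi_apply (n + 1)).prodMk (measurable_pi_apply n)) MeasurableSet.of_discrete

theorem measurableSet_arrivesAt (j : N) : MeasurableSet (M.arrivesAt j) :=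
  M.measurableSet_pathSpace.inter <|
    show MeasurableSet ((fun σ : CodeSpace E => σ 0) ⁻¹' {a | M.tExt a = j}) from
      measurable_pi_apply 0 trivial

theorem tsum_setLIntegral_arrivesAt {Λ : Measure (CodeSpace E)} (hΛ : ∀ᵐ σ ∂Λ, σ ∈ M.pathSpace)
    {g : E → CodeSpace E → ℝ≥0∞} (hg : ∀ e, AEMeasurable (g e) Λ) :
    ∑' e, ∫⁻ σ in M.arrivesAt (M.i e), g e σ ∂Λ =
      ∫⁻ σ, ∑' e : {e // M.i e = M.tExt (σ 0)}, g e σ ∂Λ := by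
  have := M.countable_index
  simp_rw [← lintegral_indicator (M.measurableSet_arrivesAt _)]
  rw [← lintegral_tsum fun e => (hg e).indicator (M.measurableSet_arrivesAt _)]
  refine lintegral_congr_ae ?_
  filter_upwards [hΛ] with σ hσ
  have hmem (e : E) : σ ∈ M.arrivesAt (M.i e) ↔ M.i e = M.tExt (σ 0) :=
    ⟨fun h => h.2.symm, fun h => ⟨hσ, h.symm⟩⟩
  refine (tsum_congr fun e => ?_).trans
    (tsum_subtype {e | M.i e = M.tExt (σ 0)} fun e => g e σ).symm
  classical simp only [Set.indicator_apply, hmem, Set.mem_ofPred_eq]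

end PathSpace

section CodingMap

variable [TopologicalSpace K] (x : ∀ j, M.V j) {σ : CodeSpace E}

theorem measurableSet_convergenceSet [TopologicalSpace.IsCompletelyMetrizableSpace K] :
    MeasurableSet (M.convergenceSet x) :=
  M.measurableSet_pathSpace.inter (StronglyMeasurable.measurableSet_exists_tendsto fun n =>
    (M.stronglyMeasurable_past_backwardOrbit x n).mono past_le)

theorem tendsto_backwardOrbit_codingMap (hσ : σ ∈ M.convergenceSet x) :
    Tendsto (fun n => M.backwardOrbit x n σ) atTop (𝓝 (M.codingMap x σ)) := by
  rw [codingMap, dif_pos hσ]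
  exact hσ.2.choose_spec

theorem codingMap_eq_of_tendsto [T2Space K] (hσ : σ ∈ M.pathSpace) {y : K}
    (hy : Tendsto (fun n => M.backwardOrbit x n σ) atTop (𝓝 y)) : M.codingMap x σ = y :=
  tendsto_nhds_unique (M.tendsto_backwardOrbit_codingMap x ⟨hσ, y, hy⟩) hy

theorem codingMap_mem_closure (hσ : σ ∈ M.convergenceSet x) :
    M.codingMap x σ ∈ closure (M.V (M.tExt (σ 0))) :=
  mem_closure_of_tendsto (M.tendsto_backwardOrbit_codingMap x hσ)
    (Eventually.of_forall (M.backwardOrbit_mem x hσ.1))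

theorem codingMap_shift [T2Space K] (hσ : σ ∈ M.convergenceSet x) {e : E}
    (he : σ 1 = Letter.of e) {y : K}
    (hy : Tendsto (M.w e) (𝓝[M.V (M.i e)] (M.codingMap x σ)) (𝓝 y)) :
    M.codingMap x (shift σ) = y := by
  have hi : M.i e = M.tExt (σ 0) := by
    rw [← (hσ.1 0).1, zero_add, he]
    rfl
  have horbit : Tendsto (fun n => M.backwardOrbit x n σ) atTop
      (𝓝[M.V (M.i e)] (M.codingMap x σ)) :=
    tendsto_nhdsWithin_iff.2 ⟨M.tendsto_backwardOrbit_codingMap x hσ,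
      Eventually.of_forall fun n => hi ▸ M.backwardOrbit_mem x hσ.1 n⟩
  refine M.codingMap_eq_of_tendsto x (M.shift_mem_pathSpace hσ.1) ?_
  rw [← tendsto_add_atTop_iff_nat 1]
  refine (hy.comp horbit).congr fun n => ?_
  rw [backwardOrbit_succ_shift, he]
  rfl

end CodingMap

/-- The map `c : E → E'` labels every edge of the Markov system by the index of the map and of the
probability function of `R` which the edge restricts. These are the properties required of the map
in `IsAssociatedWith`. -/
structure IsEdgeLabeling {E' : Type*} (R : RandomDynamicalSystem K E') (c : E → E') : Prop where
  injective : Function.Injective fun e => (c e, M.i e)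
  exists_edge : ∀ e' j, (∃ y ∈ M.V j, 0 < R.p e' y) → ∃ e, c e = e' ∧ M.i e = j
  w_eqOn : ∀ e, Set.EqOn (M.w e) (R.w (c e)) (M.V (M.i e))
  p_eqOn : ∀ e, Set.EqOn (M.p e) (R.p (c e)) (M.V (M.i e))

variable {M}

theorem IsAssociatedWith.exists_isEdgeLabeling {E' : Type*} {R : RandomDynamicalSystem K E'}
    (h : M.IsAssociatedWith R) : ∃ c, M.IsEdgeLabeling R c :=
  let ⟨c, hinj, hex, heq⟩ := h
  ⟨c, hinj, hex, fun e => (heq e).1, fun e => (heq e).2⟩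

namespace IsEdgeLabeling

variable {E' : Type*} {R : RandomDynamicalSystem K E'} {c : E → E'}

theorem markovOperator_eq_tsum_edges (hc : M.IsEdgeLabeling R c) (f : K → ℝ≥0∞) {j : N} {y : K}
    (hy : ∀ e', 0 < R.p e' y → ∃ z ∈ M.V j, 0 < R.p e' z) :
    markovOperator R.w R.p f y =
      ∑' e : {e // M.i e = j}, ENNReal.ofReal (R.p (c e) y) * f (R.w (c e) y) := by
  have hinj : Function.Injective fun e : {e // M.i e = j} => c e := fun e₁ e₂ h =>
    Subtype.ext (hc.injective (Prod.ext h (e₁.2.trans e₂.2.symm)))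
  refine (hinj.tsum_eq fun e' he' => ?_).symm
  have hpos : 0 < R.p e' y := ENNReal.ofReal_pos.1 (pos_of_ne_zero (left_ne_zero_of_mul he'))
  obtain ⟨e, he, hi⟩ := hc.exists_edge e' j (hy e' hpos)
  exact ⟨⟨e, hi⟩, he⟩

theorem markovOperator_eq (hc : M.IsEdgeLabeling R c) (f : K → ℝ≥0∞) :
    markovOperator M.w M.p f = markovOperator R.w R.p f := by
  funext y
  obtain ⟨j, hj⟩ := Set.mem_iUnion.1 (M.V_cover ▸ Set.mem_univ y)
  have hsupp : (Function.support fun e => ENNReal.ofReal (M.p e y) * f (M.w e y)) ⊆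
      {e | M.i e = j} := by
    intro e he
    by_contra hne
    have hy : y ∉ M.V (M.i e) := Set.disjoint_right.1 (M.V_disjoint hne) hj
    simp [M.p_eq_zero e y hy] at he
  rw [hc.markovOperator_eq_tsum_edges f fun _ hpos => ⟨y, hj, hpos⟩, markovOperator,
    ← tsum_subtype_eq_of_support_subset hsupp]
  refine tsum_congr fun ⟨e, he⟩ => ?_
  obtain rfl : M.i e = j := he
  rw [hc.w_eqOn e hj, hc.p_eqOn e hj]

variable [TopologicalSpace K]

theorem tendsto_w (hc : M.IsEdgeLabeling R c) {e : E} (hw : Continuous (R.w (c e))) (y : K) :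
    Tendsto (M.w e) (𝓝[M.V (M.i e)] y) (𝓝 (R.w (c e) y)) :=
  ((hw.tendsto y).mono_left nhdsWithin_le_nhds).congr'
    (hc.w_eqOn e).symm.eventuallyEq_nhdsWithin

theorem pBar_eq (hc : M.IsEdgeLabeling R c) {e : E} (hp : Continuous (R.p (c e))) {y : K}
    (hy : y ∈ closure (M.V (M.i e))) : M.pBar e y = R.p (c e) y := by
  rw [pBar, Set.indicator_of_mem hy]
  exact extendFrom_eq hy (((hp.tendsto y).mono_left nhdsWithin_le_nhds).congr'
    (hc.p_eqOn e).symm.eventuallyEq_nhdsWithin)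

end IsEdgeLabeling

namespace IsAsymptoticState

variable [TopologicalSpace K] [TopologicalSpace.IsCompletelyMetrizableSpace K] {x : ∀ j, M.V j}
  {Λ : Measure (CodeSpace E)}

theorem ae_mem_convergenceSet (hΛ : M.IsAsymptoticState x Λ) :
    ∀ᵐ σ ∂Λ, σ ∈ M.convergenceSet x :=
  have := hΛ.isProbabilityMeasure
  (mem_ae_iff_prob_eq_one (M.measurableSet_convergenceSet x)).2 hΛ.convergence

theorem aestronglyMeasurable_past_codingMap (hΛ : M.IsAsymptoticState x Λ) :
    AEStronglyMeasurable[past E] (M.codingMap x) Λ := by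
  have : Nonempty K := ⟨x ⟨1, M.one_mem⟩⟩
  refine ⟨fun σ => limUnder atTop fun n => M.backwardOrbit x n σ,
    @StronglyMeasurable.limUnder _ _ _ (past E) _ _ _ _ _ _ _
      (M.stronglyMeasurable_past_backwardOrbit x), ?_⟩
  filter_upwards [hΛ.ae_mem_convergenceSet] with σ hσ
  exact (M.tendsto_backwardOrbit_codingMap x hσ).limUnder_eq.symm

variable [BorelSpace K]

theorem aemeasurable_codingMap (hΛ : M.IsAsymptoticState x Λ) : AEMeasurable (M.codingMap x) Λ :=
  (hΛ.aestronglyMeasurable_past_codingMap.mono past_le).aemeasurable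

theorem lintegral_codingMap_shift (hΛ : M.IsAsymptoticState x Λ) {f : K → ℝ≥0∞}
    (hf : Measurable f) :
    ∫⁻ σ, f (M.codingMap x (shift σ)) ∂Λ = ∫⁻ σ, f (M.codingMap x σ) ∂Λ := by
  have hS := hΛ.shift_invariant
  have hfF := hf.comp_aemeasurable hΛ.aemeasurable_codingMap
  conv_rhs => rw [← hS.map_eq]
  exact (lintegral_map' (hS.map_eq.symm ▸ hfF) hS.measurable.aemeasurable).symm

theorem setLIntegral_nextIs (hΛ : M.IsAsymptoticState x Λ) (e : E) {h : K → ℝ≥0∞}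
    (hh : Measurable h) :
    ∫⁻ σ in nextIs e, h (M.codingMap x σ) ∂Λ =
      ∫⁻ σ in M.arrivesAt (M.i e),
        ENNReal.ofReal (M.pBar e (M.codingMap x σ)) * h (M.codingMap x σ) ∂Λ := by
  have := hΛ.isProbabilityMeasure
  have hF := hΛ.aestronglyMeasurable_past_codingMap
  have hhF : AEStronglyMeasurable[past E] (fun σ => h (M.codingMap x σ)) Λ :=
    ⟨fun σ => h (hF.mk _ σ), (hh.comp hF.stronglyMeasurable_mk.measurable).stronglyMeasurable,
      hF.ae_eq_mk.fun_comp h⟩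
  rw [← lintegral_ofReal_condExp_indicator_mul past_le (measurableSet_nextIs e) hhF,
    ← lintegral_indicator (M.measurableSet_arrivesAt _)]
  refine lintegral_congr_ae ?_
  filter_upwards [hΛ.condExp_eq e] with σ hσ
  by_cases hi : σ ∈ M.arrivesAt (M.i e) <;> simp [hσ, hi]

theorem lintegral_markovOperator_codingMap {E' : Type*} {R : RandomDynamicalSystem K E'}
    {c : E → E'} (hΛ : M.IsAsymptoticState x Λ) (hc : M.IsEdgeLabeling R c) (hR : R.IsContinuous)
    {f : K → ℝ≥0∞} (hf : Measurable f) :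
    ∫⁻ σ, markovOperator R.w R.p f (M.codingMap x σ) ∂Λ = ∫⁻ σ, f (M.codingMap x σ) ∂Λ := by
  have := M.countable_index
  have hD := hΛ.ae_mem_convergenceSet
  have hfw (e : E) : Measurable fun y => f (R.w (c e) y) := hf.comp (R.measurable_w (c e))
  symm
  calc ∫⁻ σ, f (M.codingMap x σ) ∂Λ
      = ∑' e, ∫⁻ σ in nextIs e, f (M.codingMap x (shift σ)) ∂Λ := by
        rw [← hΛ.lintegral_codingMap_shift hf]
        exact lintegral_eq_tsum_setLIntegral_nextIs (hD.mono fun σ hσ => (hσ.1 1).2) _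
    _ = ∑' e, ∫⁻ σ in nextIs e, f (R.w (c e) (M.codingMap x σ)) ∂Λ := by
        refine tsum_congr fun e => setLIntegral_congr_fun_ae (measurableSet_nextIs e) ?_
        filter_upwards [hD] with σ hσ he
        rw [M.codingMap_shift x hσ (mem_nextIs.1 he) (hc.tendsto_w (hR (c e)).1 _)]
    _ = ∑' e, ∫⁻ σ in M.arrivesAt (M.i e), ENNReal.ofReal (R.p (c e) (M.codingMap x σ)) *
          f (R.w (c e) (M.codingMap x σ)) ∂Λ := by
        refine tsum_congr fun e => (hΛ.setLIntegral_nextIs e (hfw e)).trans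
          (setLIntegral_congr_fun_ae (M.measurableSet_arrivesAt _) ?_)
        filter_upwards [hD] with σ hσ hi
        rw [hc.pBar_eq (hR (c e)).2 (hi.2 ▸ M.codingMap_mem_closure x hσ)]
    _ = ∫⁻ σ, ∑' e : {e // M.i e = M.tExt (σ 0)}, ENNReal.ofReal (R.p (c e) (M.codingMap x σ)) *
          f (R.w (c e) (M.codingMap x σ)) ∂Λ :=
        M.tsum_setLIntegral_arrivesAt (hD.mono fun _ hσ => hσ.1) fun e =>
          ((R.measurable_p (c e)).ennreal_ofReal.mul (hfw e)).comp_aemeasurable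
            hΛ.aemeasurable_codingMap
    _ = ∫⁻ σ, markovOperator R.w R.p f (M.codingMap x σ) ∂Λ := by
        refine lintegral_congr_ae ?_
        filter_upwards [hD] with σ hσ
        exact (hc.markovOperator_eq_tsum_edges f fun e' hpos =>
          exists_pos_of_mem_closure (hR e').2 (M.codingMap_mem_closure x hσ) hpos).symm

end IsAsymptoticState

end MarkovSystem

theorem theorem4_general {K E' E : Type*} [TopologicalSpace K]
    [TopologicalSpace.IsCompletelyMetrizableSpace K] [MeasurableSpace K] [BorelSpace K] {N : Set ℕ}
    (R : RandomDynamicalSystem K E') (M : MarkovSystem K E N) (hMR : M.IsAssociatedWith R)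
    (hR : R.IsContinuous) (x : ∀ j, M.V j) : M.IsConsistent x := by
  intro Λ hΛ
  obtain ⟨c, hc⟩ := hMR.exists_isEdgeLabeling
  have := hΛ.isProbabilityMeasure
  have hF := hΛ.aemeasurable_codingMap
  refine ⟨Measure.isProbabilityMeasure_map hF, fun f hf _ => ?_⟩
  rw [hc.markovOperator_eq,
    lintegral_map' (R.measurable_markovOperator hf).aemeasurable hF,
    lintegral_map' hf.aemeasurable hF, hΛ.lintegral_markovOperator_codingMap hc hR hf]

theorem theorem4 {K E' E : Type*} [MetricSpace K] [CompleteSpace K] [MeasurableSpace K]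
    [BorelSpace K] {N : Set ℕ} (R : RandomDynamicalSystem K E') (M : MarkovSystem K E N)
    (hMR : M.IsAssociatedWith R) (hR : R.IsContinuous) (hM : M.IsUniformlyContinuous)
    (hdom : M.HasDominatingMarkovChain) (x : ∀ j, M.V j) :
    M.IsConsistent x :=
  theorem4_general R M hMR hR x
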